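/- **The game.** Let $G$ be a finite graph and $q\ge 0$ an integer. In the $\operatorname{Z}_q$-forcing game on $G$, played by Blue and White, all vertices are initially white, and Blue repeatedly applies one of the following rules until all vertices are blue. Here $B$ denotes the current set of blue vertices. 1. For one token, Blue turns any white vertex blue. 2. At no cost, if a blue vertex $v$ has exactly one white neighbor $w$ in $G$, Blue turns $w$ blue. 3. Blue announces a set of at least $q+1$ connected components of $G[V(G)\setminus B]$. White answers with a nonempty subset $\{W_{1},\dots,W_{\ell}\}$ of this set. At no cost, Blue may then apply Rule 2 once in the induced subgraph $G[B\cup W_{1}\cup\dots\cup W_{\ell}]$. $\operatorname{Z}_q(G)$ is the smallest number of tokens with which Blue can turn all of $G$ blue against every play of White. **The graph.** For $n\ge 3$ and $k\ge 2$, let $C_{n,k}$ denote any graph obtained from the cycle $C_n$ by attaching to each vertex of $C_n$ at least $2$ and at most $k$ pendant vertices (their number may vary from vertex to vertex). **Theorem.** Let $n\ge 3$ and $k,q\ge 2$ be integers, and let $p=q+1+x$, where $x\ge 0$ is an integer with $x\equiv q+1 \pmod 2$. Then, for every such graph $C_{n,k}$, \[\operatorname{Z}_q(C_{n,k})\le (p-2)\log_2(n)+p+k-q+q(k-1),\]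 and, if moreover $q\ge 3$, \[2\log_3(2)\,\log_2\!\left(\tfrac{n}{200}\right)\le \operatorname{Z}_q(C_{n,k}).\] -/

import Mathlib

/-- `IsForce G B U v w`: the blue vertex `v` may turn `w` blue by the ordinary zero forcing rule in
the induced subgraph `G[B ∪ U]`, where `B` is the set of blue vertices, that is, `w` is the only
white neighbor of `v` in `G[B ∪ U]`. -/
def IsForce {V : Type*} (G : SimpleGraph V) (B U : Set V) (v w : V) : Prop :=
  v ∈ B ∧ G.neighborSet v ∩ (U \ B) = {w}

/-- The white components, for the blue set `B`: the connected components of `G[V \ B]`. -/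
abbrev WhiteComponent {V : Type*} (G : SimpleGraph V) (B : Set V) : Type _ :=
  (G.induce Bᶜ).ConnectedComponent

/-- The union of the vertex sets of a set of white components. -/
def whiteUnion {V : Type*} (G : SimpleGraph V) (B : Set V) (S : Set (WhiteComponent G B)) :
    Set V :=
  {w | ∃ h : w ∈ Bᶜ, (G.induce Bᶜ).connectedComponentMk ⟨w, h⟩ ∈ S}

/-- `BlueWins G q t B`: in the `Z_q`-forcing game on `G`, from the position in which `B` is the set
of blue vertices, Blue can turn all vertices blue, whatever White does, by spending at most `t`
further tokens. Being inductive, it only allows plays of finite length. -/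
inductive BlueWins {V : Type*} (G : SimpleGraph V) (q : ℕ) : ℕ → Set V → Prop
  /-- All the vertices are blue. -/
  | done (t : ℕ) : BlueWins G q t Set.univ
  /-- Rule 1: for one token, a white vertex is turned blue. -/
  | token (t : ℕ) (B : Set V) (v : V) (hv : v ∉ B)
      (h : BlueWins G q t (insert v B)) : BlueWins G q (t + 1) B
  /-- Rule 2: a blue vertex with exactly one white neighbor in `G` turns this neighbor blue. -/
  | force (t : ℕ) (B : Set V) (v w : V) (hvw : IsForce G B Set.univ v w)
      (h : BlueWins G q t (insert w B)) : BlueWins G q t B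
  /-- Rule 3: Blue announces a set `W` of at least `q + 1` white components; White answers with a
  nonempty subset `S` of it; the next position `next S`, chosen by Blue in answer to `S`, arises
  by one application of Rule 2 in the subgraph induced by the blue vertices and the components in
  `S`, or is the same position (Blue need not, and maybe cannot, make such a force). -/
  | select (t : ℕ) (B : Set V) (W : Set (WhiteComponent G B)) (hW : (q : ℕ∞) + 1 ≤ W.encard)
      (next : Set (WhiteComponent G B) → Set V)
      (hnext : ∀ S, S ⊆ W → S.Nonempty →
        next S = B ∨ ∃ v w, IsForce G B (whiteUnion G B S) v w ∧ next S = insert w B)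
      (h : ∀ S, S ⊆ W → S.Nonempty → BlueWins G q t (next S)) : BlueWins G q t B

/-- The parameter `Z_q(G)` of a finite graph: the fewest tokens with which Blue can color the whole
graph blue in the `Z_q`-forcing game that starts with all vertices white, against any play of
White. (The infimum is over a nonempty set, see `exists_blueWins`.) -/
noncomputable def Zq {V : Type*} (G : SimpleGraph V) (q : ℕ) : ℕ :=
  sInf {t : ℕ | BlueWins G q t ∅}

/-- On a finite graph, enough tokens suffice. -/
theorem exists_blueWins {V : Type*} [Finite V] (G : SimpleGraph V) (q : ℕ) :
    ∃ t : ℕ, BlueWins G q t ∅ := by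
  suffices h : ∀ (m : ℕ) (B : Set V), Bᶜ.ncard = m → BlueWins G q m B from ⟨_, h _ ∅ rfl⟩
  intro m
  induction m with
  | zero =>
    intro B hB
    have : B = Set.univ := by
      simpa using (Set.ncard_eq_zero (Set.toFinite _)).1 hB
    rw [this]
    exact BlueWins.done 0
  | succ m ih =>
    intro B hB
    obtain ⟨v, hv⟩ : (Bᶜ).Nonempty := by
      rw [← Set.ncard_pos (Set.toFinite _)]
      omega
    refine BlueWins.token m B v hv (ih _ ?_)
    have h1 : (insert v B)ᶜ = Bᶜ \ {v} := by
      ext u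
      simp [not_or, and_comm]
    rw [h1, Set.ncard_sdiff_singleton_of_mem hv]
    omega

/-- The caterpillar cycle: the cycle on the `n` centers `Sum.inl i`, with `d i` pendant vertices
`Sum.inr ⟨i, a⟩` attached to the center `Sum.inl i`. -/
def caterpillarCycle (n : ℕ) (d : Fin n → ℕ) : SimpleGraph (Fin n ⊕ (Σ i : Fin n, Fin (d i))) where
  Adj u v :=
    match u, v with
    | Sum.inl i, Sum.inl j => (SimpleGraph.cycleGraph n).Adj i j
    | Sum.inl i, Sum.inr b => i = b.1
    | Sum.inr a, Sum.inl j => a.1 = j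
    | Sum.inr _, Sum.inr _ => False
  symm := ⟨by
    rintro (i | a) (j | b) h
    · exact SimpleGraph.Adj.symm h
    · exact Eq.symm h
    · exact Eq.symm h
    · exact h⟩
  loopless := ⟨by
    rintro (i | a) h
    · exact (SimpleGraph.cycleGraph n).irrefl h
    · exact h⟩

/-! Lower bound. Call a center with its pendant vertices a column. White preserves an interval of
wholly white columns between walls, that is, columns that keep a white pendant vertex. A wall center
has this pendant vertex and a center of the interval as white neighbors, so it never forces by Rule
2. There are at most three walls and at least `q + 1 ≥ 4` announced components, so by
`exists_answer_no_force` some answer blocks all wall centers. Hence only tokens harm White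
(`Guarded.insert_of_force`). A token between two walls makes a third wall; after one more token, one
of at most three intervals survives, with about a third of the length. So two tokens cost a factor
`3` (`Safe.insert_token`), and about `2 log_3 n` tokens are needed.

Upper bound. Blue keeps every blue center next to another one on the cycle. An active center without
white pendant vertices then has just one white neighbor and forces it. If instead more than `q`
active centers all have white pendant vertices, Blue announces one at each, and every answer permits
a force. So Blue reaches at most `q` active centers without tokens (`blueWins_of_active_le`). Each
gap between blue centers has two active ends, so there are at most `q / 2` gaps, and two adjacent
tokens halve one. After about `log_2 n` rounds all centers are blue, and `k - 1` tokens at each of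
at most `q` active centers finish. -/

open SimpleGraph

/-! ### White's answers, and adjacency in the cycle -/

/-- If White has more announced components than there are vertices in `K`, then White has a
nonempty answer after which no vertex of `K` can force. -/
theorem exists_answer_no_force {V : Type*} (G : SimpleGraph V) (B : Set V) (K : Finset V) :
    ∀ W : Finset (WhiteComponent G B), K.card < W.card →
      ∃ S : Set (WhiteComponent G B), S ⊆ W ∧ S.Nonempty ∧
        ∀ v ∈ K, ∀ w, ¬ IsForce G B (whiteUnion G B S) v w := by
  classical
  induction hm : K.card generalizing K with
  | zero =>
    intro W hW
    refine ⟨W, subset_rfl, Finset.coe_nonempty.2 (Finset.card_pos.1 hW), fun v hv => ?_⟩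
    rw [Finset.card_eq_zero.1 hm] at hv
    simp at hv
  | succ m ih =>
    intro W hW
    by_cases hWf : ∀ v ∈ K, ∀ w, ¬ IsForce G B (whiteUnion G B W) v w
    · exact ⟨W, subset_rfl, Finset.coe_nonempty.2 (Finset.card_pos.1 (by omega)), hWf⟩
    push Not at hWf
    obtain ⟨v, hv, w, hvB, hvw⟩ := hWf
    have hw : w ∈ G.neighborSet v ∩ (whiteUnion G B W \ B) := hvw ▸ Set.mem_singleton w
    obtain ⟨hwB, hwW⟩ := hw.2.1
    -- The component of `w` contains the only white neighbor of `v` in the answer `W`. Without it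
    -- `v` can force nothing, so `v` leaves `K`.
    obtain ⟨S, hSW, hS, hSf⟩ := ih (K.erase v) (by rw [Finset.card_erase_of_mem hv]; omega)
      (W.erase ((G.induce Bᶜ).connectedComponentMk ⟨w, hwB⟩))
      (by rw [Finset.card_erase_of_mem (by exact_mod_cast hwW)]; omega)
    have hSW' : S ⊆ W := fun c hc => Finset.mem_of_mem_erase (by exact_mod_cast hSW hc)
    refine ⟨S, hSW', hS, fun u hu z hz => ?_⟩
    by_cases huv : u = v
    · subst huv
      have hz' : z ∈ G.neighborSet u ∩ (whiteUnion G B S \ B) := hz.2 ▸ Set.mem_singleton z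
      obtain ⟨hz1, ⟨hzB, hzS⟩, -⟩ := hz'
      have : z ∈ G.neighborSet u ∩ (whiteUnion G B W \ B) := ⟨hz1, ⟨hzB, hSW' hzS⟩, hzB⟩
      rw [hvw, Set.mem_singleton_iff] at this
      subst this
      have := hSW hzS
      simp at this
    · exact hSf u (Finset.mem_erase.2 ⟨huv, hu⟩) z hz

theorem cycleGraph_adj_val {n : ℕ} {i j : Fin n} (h : (cycleGraph n).Adj i j) :
    (i : ℕ) + 1 = j ∨ (j : ℕ) + 1 = i ∨ ((i : ℕ) = 0 ∧ (j : ℕ) + 1 = n) ∨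
      ((j : ℕ) = 0 ∧ (i : ℕ) + 1 = n) := by
  rw [cycleGraph_adj'] at h
  have hi := i.2
  have hj := j.2
  rw [Fin.val_sub, Fin.val_sub] at h
  rcases h with h | h
  · rcases lt_or_ge (n - (j : ℕ) + i) n with h1 | h1
    · rw [Nat.mod_eq_of_lt h1] at h; omega
    · rw [Nat.mod_eq_sub_mod h1, Nat.mod_eq_of_lt (by omega)] at h; omega
  · rcases lt_or_ge (n - (i : ℕ) + j) n with h1 | h1
    · rw [Nat.mod_eq_of_lt h1] at h; omega
    · rw [Nat.mod_eq_sub_mod h1, Nat.mod_eq_of_lt (by omega)] at h; omega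

theorem cycleGraph_adj_of_val {n : ℕ} {i j : Fin n} (h : (i : ℕ) + 1 = j) :
    (cycleGraph n).Adj i j := by
  rw [cycleGraph_adj']
  right
  have hi := i.2
  have hj := j.2
  rw [Fin.val_sub, Nat.mod_eq_sub_mod (by omega), Nat.mod_eq_of_lt (by omega)]
  omega

/-! ### Lower bound: white intervals between walls -/

namespace caterpillarCycle

variable {n : ℕ} {d : Fin n → ℕ}

/-- The index of the center to which a vertex belongs. -/
def column : Fin n ⊕ (Σ i : Fin n, Fin (d i)) → ℕ
  | Sum.inl i => i
  | Sum.inr b => b.1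

/-- All vertices in the column `i` are white. -/
def Pristine (B : Set (Fin n ⊕ (Σ i : Fin n, Fin (d i)))) (i : ℕ) : Prop :=
  ∀ u, column u = i → u ∉ B

/-- The column `i` has a white pendant vertex. -/
def HasWhiteLeaf (B : Set (Fin n ⊕ (Σ i : Fin n, Fin (d i)))) (i : ℕ) : Prop :=
  ∃ b : Σ i : Fin n, Fin (d i), (b.1 : ℕ) = i ∧ Sum.inr b ∉ B

variable {B : Set (Fin n ⊕ (Σ i : Fin n, Fin (d i)))}

theorem Pristine.insert {i : ℕ} (h : Pristine B i) {u} (hu : column u ≠ i) :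
    Pristine (insert u B) i := by
  rintro v hv (rfl | hvB)
  · exact hu hv
  · exact h v hv hvB

theorem HasWhiteLeaf.insert {i : ℕ} (h : HasWhiteLeaf B i) {u} (hu : column u ≠ i) :
    HasWhiteLeaf (insert u B) i := by
  obtain ⟨b, hb, hbB⟩ := h
  refine ⟨b, hb, ?_⟩
  rintro (rfl | h)
  · exact hu hb
  · exact hbB h

theorem HasWhiteLeaf.insert_of_ne {i : ℕ} (h : HasWhiteLeaf B i) {u}
    (hu : ∀ b : Σ i : Fin n, Fin (d i), (b.1 : ℕ) = i → u ≠ Sum.inr b) :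
    HasWhiteLeaf (Insert.insert u B) i := by
  obtain ⟨b, hb, hbB⟩ := h
  refine ⟨b, hb, ?_⟩
  rintro (h | h)
  · exact hu b hb h.symm
  · exact hbB h

theorem HasWhiteLeaf.lt {i : ℕ} (h : HasWhiteLeaf B i) : i < n := by
  obtain ⟨b, rfl, -⟩ := h
  exact b.1.2

/-- With two pendant vertices at each center, a white column hit by one token can still serve as a
wall. -/
theorem Pristine.hasWhiteLeaf_insert (hd : ∀ i, 2 ≤ d i) {i : ℕ} (h : Pristine B i) (hi : i < n)
    (u) : HasWhiteLeaf (Insert.insert u B) i := by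
  have h2 := hd ⟨i, hi⟩
  by_cases hu : u = Sum.inr ⟨⟨i, hi⟩, ⟨0, by omega⟩⟩
  · refine ⟨⟨⟨i, hi⟩, ⟨1, by omega⟩⟩, rfl, ?_⟩
    rintro (h' | h')
    · rw [hu] at h'
      simp at h'
    · exact h _ rfl h'
  · refine ⟨⟨⟨i, hi⟩, ⟨0, by omega⟩⟩, rfl, ?_⟩
    rintro (h' | h')
    · exact hu h'.symm
    · exact h _ rfl h'

/-- The columns in `P` are white, and can only be entered through the columns in `K`, whose centers
cannot force by the ordinary zero forcing rule. -/
structure Guarded (B : Set (Fin n ⊕ (Σ i : Fin n, Fin (d i)))) (P : Set ℕ) (K : Finset ℕ) :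
    Prop where
  pristine : ∀ i ∈ P, Pristine B i
  leaf : ∀ i ∈ K, HasWhiteLeaf B i
  boundary : ∀ i j : Fin n, (cycleGraph n).Adj i j → (i : ℕ) ∈ P → (j : ℕ) ∈ P ∨ (j : ℕ) ∈ K
  inner : ∀ i : Fin n, (i : ℕ) ∈ K → ∃ j : Fin n, (cycleGraph n).Adj i j ∧ (j : ℕ) ∈ P

/-- A vertex of `P` could be forced only from `P`, which has no blue vertex, or by a wall center; a
pendant vertex of a wall only by its own center. A wall center may itself turn blue without harm. -/
theorem Guarded.insert_of_force {P : Set ℕ} {K : Finset ℕ} (h : Guarded B P K) {U v w}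
    (hvw : IsForce (caterpillarCycle n d) B U v w)
    (hv : U = Set.univ ∨ ∀ i : Fin n, v = Sum.inl i → (i : ℕ) ∉ K) :
    Guarded (insert w B) P K := by
  have hv' : ∀ i : Fin n, v = Sum.inl i → (i : ℕ) ∉ K := by
    rcases hv with rfl | hv
    · rintro i rfl hi
      obtain ⟨b, hb, hbB⟩ := h.leaf i hi
      obtain ⟨j, hij, hj⟩ := h.inner i hi
      have h1 : Sum.inr b ∈ (caterpillarCycle n d).neighborSet (Sum.inl i) ∩ (Set.univ \ B) :=
        ⟨(Fin.ext hb.symm : i = b.1), trivial, hbB⟩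
      have h2 : Sum.inl j ∈ (caterpillarCycle n d).neighborSet (Sum.inl i) ∩ (Set.univ \ B) :=
        ⟨hij, trivial, h.pristine j hj _ rfl⟩
      rw [hvw.2, Set.mem_singleton_iff] at h1 h2
      rw [← h1] at h2
      exact absurd h2 (by simp)
    · exact hv
  have hw : w ∈ (caterpillarCycle n d).neighborSet v ∩ (U \ B) := hvw.2 ▸ Set.mem_singleton w
  have hadj : (caterpillarCycle n d).Adj v w := hw.1
  have hvB := hvw.1
  refine ⟨fun i hi => (h.pristine i hi).insert ?_, fun i hi => (h.leaf i hi).insert_of_ne ?_,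
    h.boundary, h.inner⟩
  · rintro rfl
    rcases v with v | v <;> rcases w with w | w
    · rcases h.boundary w v hadj.symm hi with hp | hk
      · exact h.pristine _ hp _ rfl hvB
      · exact hv' v rfl hk
    · obtain rfl : v = w.1 := hadj
      exact h.pristine _ hi (Sum.inl w.1) rfl hvB
    · obtain rfl : v.1 = w := hadj
      exact h.pristine _ hi (Sum.inr v) rfl hvB
    · exact hadj
  · rintro b hb rfl
    rcases v with v | v
    · obtain rfl : v = b.1 := hadj
      exact hv' _ rfl (hb ▸ hi)
    · exact hadj

theorem guarded_Ioo {x y : ℕ} (hxy : x + 2 ≤ y) (hP : ∀ i, x < i → i < y → Pristine B i)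
    (hx : HasWhiteLeaf B x) (hy : HasWhiteLeaf B y) : Guarded B (Set.Ioo x y) {x, y} := by
  have hyn := hy.lt
  refine ⟨fun i hi => hP i hi.1 hi.2, ?_, fun i j hij hi => ?_, fun i hi => ?_⟩
  · simp only [Finset.mem_insert, Finset.mem_singleton]
    rintro i (rfl | rfl) <;> assumption
  · have := cycleGraph_adj_val hij
    simp only [Finset.mem_insert, Finset.mem_singleton, Set.mem_Ioo] at hi ⊢
    omega
  · simp only [Finset.mem_insert, Finset.mem_singleton] at hi
    rcases hi with hi | hi
    · exact ⟨⟨x + 1, by omega⟩, cycleGraph_adj_of_val (by simp [hi]),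
        by simp only [Set.mem_Ioo]; omega⟩
    · exact ⟨⟨y - 1, by omega⟩, (cycleGraph_adj_of_val (by simp only; omega)).symm,
        by simp only [Set.mem_Ioo]; omega⟩

theorem guarded_Ioo_sdiff {x m y : ℕ} (hxm : x + 2 ≤ m) (hmy : m + 2 ≤ y)
    (hP : ∀ i, x < i → i < y → i ≠ m → Pristine B i) (hx : HasWhiteLeaf B x)
    (hm : HasWhiteLeaf B m) (hy : HasWhiteLeaf B y) :
    Guarded B (Set.Ioo x y \ {m}) {x, m, y} := by
  have hyn := hy.lt
  refine ⟨fun i hi => hP i hi.1.1 hi.1.2 hi.2, ?_, fun i j hij hi => ?_, fun i hi => ?_⟩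
  · simp only [Finset.mem_insert, Finset.mem_singleton]
    rintro i (rfl | rfl | rfl) <;> assumption
  · have := cycleGraph_adj_val hij
    simp only [Finset.mem_insert, Finset.mem_singleton, Set.mem_Ioo, Set.mem_sdiff,
      Set.mem_singleton_iff] at hi ⊢
    omega
  · simp only [Finset.mem_insert, Finset.mem_singleton] at hi
    rcases hi with hi | hi | hi
    · exact ⟨⟨x + 1, by omega⟩, cycleGraph_adj_of_val (by simp [hi]),
        by simp only [Set.mem_Ioo, Set.mem_sdiff, Set.mem_singleton_iff]; omega⟩
    · exact ⟨⟨m + 1, by omega⟩, cycleGraph_adj_of_val (by simp [hi]),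
        by simp only [Set.mem_Ioo, Set.mem_sdiff, Set.mem_singleton_iff]; omega⟩
    · exact ⟨⟨y - 1, by omega⟩, (cycleGraph_adj_of_val (by simp only; omega)).symm,
        by simp only [Set.mem_Ioo, Set.mem_sdiff, Set.mem_singleton_iff]; omega⟩

/-- A white interval of columns of length `safeLength t` withstands `t` tokens. -/
def safeLength : ℕ → ℕ
  | 0 => 2
  -- This leaves room for three walls with white columns between them after an end wall moves
  -- inward.
  | 1 => 5
  | t + 2 => 3 * safeLength t

/-- The recursion has step two, so the induction carries two consecutive values. -/
theorem safeLength_spec (t : ℕ) : 2 ≤ safeLength t ∧ 5 ≤ safeLength (t + 1) ∧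
    2 * safeLength t + 2 ≤ safeLength (t + 2) ∧ safeLength t ^ 2 ≤ 100 * 3 ^ t ∧
    safeLength (t + 1) ^ 2 ≤ 100 * 3 ^ (t + 1) := by
  induction t with
  | zero => simp [safeLength]
  | succ t ih =>
    obtain ⟨h1, h2, h3, h4, h5⟩ := ih
    have h6 : safeLength (t + 1 + 2) = 3 * safeLength (t + 1) := rfl
    have h7 : safeLength (t + 1 + 1) = 3 * safeLength t := rfl
    refine ⟨by omega, by omega, by omega, h5, ?_⟩
    rw [h7, mul_pow, pow_succ, pow_succ]
    omega

/-- The positions that White can hold against `t` further tokens: either two walls enclose a long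
white interval, or three walls enclose two white intervals of large total length. -/
inductive Safe (t : ℕ) (B : Set (Fin n ⊕ (Σ i : Fin n, Fin (d i)))) : Prop
  | two (x y : ℕ) (hxy : x + safeLength t ≤ y) (h : Guarded B (Set.Ioo x y) {x, y})
  | three (x m y : ℕ) (hxm : x + 2 ≤ m) (hmy : m + 2 ≤ y) (hxy : x + safeLength (t + 1) ≤ y + 1)
    (h : Guarded B (Set.Ioo x y \ {m}) {x, m, y})

theorem Safe.exists_guarded {t : ℕ} (h : Safe t B) : ∃ P K, K.card ≤ 3 ∧ Guarded B P K ∧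
    ∀ B' : Set (Fin n ⊕ (Σ i : Fin n, Fin (d i))),
      Guarded B' P K → Safe t B' := by
  cases h with
  | two x y hxy h =>
    exact ⟨_, _, Finset.card_le_two.trans (by omega), h, fun B' h' => .two x y hxy h'⟩
  | three x m y hxm hmy hxy h =>
    exact ⟨_, _, Finset.card_le_three, h, fun B' h' => .three x m y hxm hmy hxy h'⟩

theorem Safe.ne_univ {t : ℕ} (h : Safe t B) : B ≠ Set.univ := by
  rintro rfl
  have : ∃ i, HasWhiteLeaf (Set.univ : Set (Fin n ⊕ (Σ i : Fin n, Fin (d i)))) i := by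
    cases h with
    | two x y hxy h => exact ⟨x, h.leaf x (by simp)⟩
    | three x m y hxm hmy hxy h => exact ⟨x, h.leaf x (by simp)⟩
  obtain ⟨i, b, -, hb⟩ := this
  exact hb trivial

/-- With two walls, the column of the token becomes the middle wall; if it is too close to an end
wall, that wall moves inward. With three walls, `y - x ≥ 3 * safeLength t - 1`, so one of the at
most three intervals cut out by `m` and the token has length at least `safeLength t`, even if a wall
that was hit is moved by one column. -/
theorem Safe.insert_token (hd : ∀ i, 2 ≤ d i) {t : ℕ} (h : Safe (t + 1) B) (u) :
    Safe t (insert u B) := by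
  obtain ⟨s1, s2, s3, -, -⟩ := safeLength_spec t
  have s4 : safeLength (t + 1 + 1) = 3 * safeLength t := rfl
  set c := column u with hc
  have hPr : ∀ i, Pristine B i → c ≠ i → Pristine (insert u B) i := fun i h hi => h.insert hi
  have hL : ∀ i, HasWhiteLeaf B i → c ≠ i → HasWhiteLeaf (insert u B) i :=
    fun i h hi => h.insert hi
  have hPL : ∀ i, Pristine B i → i < n → HasWhiteLeaf (insert u B) i :=
    fun i h hi => h.hasWhiteLeaf_insert hd hi u
  cases h with
  | two x y hxy h =>
    have hP : ∀ i, x < i → i < y → Pristine B i := fun i h1 h2 => h.pristine i ⟨h1, h2⟩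
    have hx := h.leaf x (by simp)
    have hy := h.leaf y (by simp)
    have hyn := hy.lt
    -- The `+ 1` in `Safe.three` pays for moving one end wall by one column.
    have key : ∀ x' m y', x ≤ x' → y' ≤ y → x' + 2 ≤ m → m + 2 ≤ y' →
        x' + safeLength (t + 1) ≤ y' + 1 → (x' = x → c ≠ x) → (y' = y → c ≠ y) →
        (x' < c → c < y' → c = m) → Safe t (insert u B) := by
      intro x' m y' h1 h2 h3 h4 h5 h6 h7 h8
      refine .three x' m y' h3 h4 h5 (guarded_Ioo_sdiff h3 h4 (fun i hi1 hi2 hi3 =>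
        hPr i (hP i (by omega) (by omega)) (fun h => ?_)) ?_ ?_ ?_)
      · have := h8 (by omega) (by omega)
        omega
      · rcases h1.eq_or_lt with rfl | h
        · exact hL _ hx (h6 rfl)
        · exact hPL _ (hP _ h (by omega)) (by omega)
      · exact hPL _ (hP _ (by omega) (by omega)) (by omega)
      · rcases h2.eq_or_lt with rfl | h
        · exact hL _ hy (h7 rfl)
        · exact hPL _ (hP _ (by omega) h) (by omega)
    by_cases c1 : c = x ∨ c = x + 1
    · exact key (x + 1) (x + 3) y (by omega) (by omega) (by omega) (by omega) (by omega) (by omega)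
        (by omega) (by omega)
    by_cases c2 : c = y ∨ c + 1 = y
    · exact key x (x + 2) (y - 1) (by omega) (by omega) (by omega) (by omega) (by omega) (by omega)
        (by omega) (by omega)
    by_cases c3 : x < c ∧ c < y
    · exact key x c y (by omega) (by omega) (by omega) (by omega) (by omega) (by omega)
        (by omega) (by omega)
    · exact key x (x + 2) y (by omega) (by omega) (by omega) (by omega) (by omega) (by omega)
        (by omega) (by omega)
  | three x m y hxm hmy hxy h =>
    have hP : ∀ i, x < i → i < y → i ≠ m → Pristine B i :=
      fun i h1 h2 h3 => h.pristine i ⟨⟨h1, h2⟩, h3⟩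
    have hx := h.leaf x (by simp)
    have hm := h.leaf m (by simp)
    have hy := h.leaf y (by simp)
    have hyn := hy.lt
    have hW : ∀ i, x ≤ i → i ≤ y → (i = x → c ≠ x) → (i = m → c ≠ m) → (i = y → c ≠ y) →
        HasWhiteLeaf (insert u B) i := by
      intro i h1 h2 h3 h4 h5
      by_cases e1 : i = x
      · subst e1; exact hL _ hx (h3 rfl)
      by_cases e2 : i = m
      · subst e2; exact hL _ hm (h4 rfl)
      by_cases e3 : i = y
      · subst e3; exact hL _ hy (h5 rfl)
      · exact hPL i (hP i (by omega) (by omega) e2) (by omega)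
    have key : ∀ x' y', x ≤ x' → y' ≤ y → x' + safeLength t ≤ y' → (y' ≤ m ∨ m ≤ x') →
        (x' = x → c ≠ x) → (x' = m → c ≠ m) → (y' = m → c ≠ m) → (y' = y → c ≠ y) →
        ¬ (x' < c ∧ c < y') → Safe t (insert u B) := by
      intro x' y' h1 h2 h3 h4 h5 h6 h7 h8 h9
      exact .two x' y' h3 (guarded_Ioo (by omega)
        (fun i hi1 hi2 => hPr i (hP i (by omega) (by omega) (by omega)) (by omega))
        (hW _ (by omega) (by omega) h5 h6 (by omega))
        (hW _ (by omega) (by omega) (by omega) h7 h8))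
    by_cases c1 : c = x
    · by_cases c2 : x + 1 + safeLength t ≤ m
      · exact key (x + 1) m (by omega) (by omega) c2 (by omega) (by omega) (by omega) (by omega)
          (by omega) (by omega)
      · exact key m y (by omega) (by omega) (by omega) (by omega) (by omega) (by omega) (by omega)
          (by omega) (by omega)
    by_cases c2 : c = y
    · by_cases c2 : m + 1 + safeLength t ≤ y
      · exact key m (y - 1) (by omega) (by omega) (by omega) (by omega) (by omega) (by omega)
          (by omega) (by omega) (by omega)
      · exact key x m (by omega) (by omega) (by omega) (by omega) (by omega) (by omega) (by omega)
          (by omega) (by omega)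
    by_cases c3 : c = m
    · by_cases c2 : x + 1 + safeLength t ≤ m
      · exact key x (m - 1) (by omega) (by omega) (by omega) (by omega) (by omega) (by omega)
          (by omega) (by omega) (by omega)
      · exact key (m + 1) y (by omega) (by omega) (by omega) (by omega) (by omega) (by omega)
          (by omega) (by omega) (by omega)
    by_cases c4 : x < c ∧ c < m
    · by_cases c5 : x + safeLength t ≤ c
      · exact key x c (by omega) (by omega) (by omega) (by omega) (by omega) (by omega)
          (by omega) (by omega) (by omega)
      by_cases c6 : c + safeLength t ≤ m
      · exact key c m (by omega) (by omega) (by omega) (by omega) (by omega) (by omega)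
          (by omega) (by omega) (by omega)
      · exact key m y (by omega) (by omega) (by omega) (by omega) (by omega) (by omega) (by omega)
          (by omega) (by omega)
    by_cases c7 : m < c ∧ c < y
    · by_cases c5 : m + safeLength t ≤ c
      · exact key m c (by omega) (by omega) (by omega) (by omega) (by omega) (by omega)
          (by omega) (by omega) (by omega)
      by_cases c6 : c + safeLength t ≤ y
      · exact key c y (by omega) (by omega) (by omega) (by omega) (by omega) (by omega)
          (by omega) (by omega) (by omega)
      · exact key x m (by omega) (by omega) (by omega) (by omega) (by omega) (by omega) (by omega)
          (by omega) (by omega)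
    by_cases c8 : x + safeLength t ≤ m
    · exact key x m (by omega) (by omega) (by omega) (by omega) (by omega) (by omega) (by omega)
        (by omega) (by omega)
    · exact key m y (by omega) (by omega) (by omega) (by omega) (by omega) (by omega) (by omega)
        (by omega) (by omega)

theorem not_safe_of_blueWins (hd : ∀ i, 2 ≤ d i) {q t : ℕ} (hq : 3 ≤ q)
    (h : BlueWins (caterpillarCycle n d) q t B) : ¬ Safe t B := by
  classical
  induction h with
  | done t => exact fun h => h.ne_univ rfl
  | token t B v hv h ih => exact fun hs => ih (hs.insert_token hd v)
  | force t B v w hvw h ih =>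
    intro hs
    obtain ⟨P, K, -, hG, hs'⟩ := hs.exists_guarded
    exact ih (hs' _ (hG.insert_of_force hvw (.inl rfl)))
  | select t B W hW next hnext h ih =>
    intro hs
    obtain ⟨P, K, hK, hG, hs'⟩ := hs.exists_guarded
    have hWf : W.Finite := Set.toFinite W
    obtain ⟨S, hSW, hS, hSf⟩ := exists_answer_no_force (caterpillarCycle n d) B
      ((Finset.univ.filter fun i : Fin n => (i : ℕ) ∈ K).image Sum.inl) hWf.toFinset (by
        rw [hWf.encard_eq_coe_toFinset_card] at hW
        have h1 : q + 1 ≤ hWf.toFinset.card := by exact_mod_cast hW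
        have h2 : (Finset.univ.filter fun i : Fin n => (i : ℕ) ∈ K).card ≤ K.card :=
          Finset.card_le_card_of_injOn (fun i => (i : ℕ)) (by intro i; simp)
            (fun i _ j _ h => Fin.ext h)
        have h3 := Finset.card_image_le (f := (Sum.inl : Fin n → Fin n ⊕ (Σ i : Fin n, Fin (d i))))
          (s := Finset.univ.filter fun i : Fin n => (i : ℕ) ∈ K)
        omega)
    rw [hWf.coe_toFinset] at hSW
    rcases hnext S hSW hS with heq | ⟨v, w, hvw, heq⟩
    · exact ih S hSW hS (heq ▸ hs)
    · refine ih S hSW hS (heq ▸ hs' _ (hG.insert_of_force hvw (.inr ?_)))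
      rintro i rfl hi
      exact hSf (Sum.inl i) (by simpa using hi) w hvw

theorem le_safeLength_of_blueWins (hd : ∀ i, 2 ≤ d i) {q t : ℕ} (hq : 3 ≤ q)
    (h : BlueWins (caterpillarCycle n d) q t ∅) : n ≤ safeLength t := by
  by_contra! hn
  have h2 := (safeLength_spec t).1
  have hL : ∀ i, i < n → HasWhiteLeaf (∅ : Set (Fin n ⊕ (Σ i : Fin n, Fin (d i)))) i :=
    fun i hi => ⟨⟨⟨i, hi⟩, ⟨0, by have := hd ⟨i, hi⟩; omega⟩⟩, rfl, id⟩
  -- The first and last columns, adjacent on the cycle, are the two walls.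
  exact not_safe_of_blueWins hd hq h (.two 0 (n - 1) (by omega) (guarded_Ioo (by omega)
    (fun _ _ _ _ _ => id) (hL _ (by omega)) (hL _ (by omega))))

theorem logb_le_of_blueWins (hd : ∀ i, 2 ≤ d i) (hn : 0 < n) {q t : ℕ} (hq : 3 ≤ q)
    (h : BlueWins (caterpillarCycle n d) q t ∅) :
    2 * Real.logb 3 2 * Real.logb 2 ((n : ℝ) / 200) ≤ t := by
  rw [mul_assoc, Real.mul_logb (by norm_num) (by norm_num) (by norm_num)]
  have hle := le_safeLength_of_blueWins hd hq h
  have hsq := (safeLength_spec t).2.2.2.1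
  have h1 : ((n : ℝ) / 200) ^ 2 ≤ 3 ^ t := by
    have h2 : n ^ 2 ≤ 100 * 3 ^ t := (Nat.pow_le_pow_left hle 2).trans hsq
    have h3 : (n : ℝ) ^ 2 ≤ 100 * 3 ^ t := by exact_mod_cast h2
    have h4 : (0 : ℝ) < 3 ^ t := by positivity
    rw [div_pow]
    linarith
  have h5 := Real.logb_le_logb_of_le (b := 3) (by norm_num) (by positivity) h1
  rwa [Real.logb_pow, Real.logb_pow, Real.logb_self_eq_one (by norm_num), mul_one,
    Nat.cast_ofNat] at h5

end caterpillarCycle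

/-! ### Gaps of a set under a permutation -/

section Gaps

variable {α : Type*} {σ : Equiv.Perm α} {A : Set α} {g c : ℕ}

/-- The elements of `A` that need at least `g` steps of `σ` to return to `A`. -/
def longGaps (σ : Equiv.Perm α) (A : Set α) (g : ℕ) : Set α :=
  {i ∈ A | ∀ m, 1 ≤ m → m < g → (σ ^ m) i ∉ A}

theorem longGaps_anti {g' : ℕ} (h : g' ≤ g) : longGaps σ A g ⊆ longGaps σ A g' :=
  fun _ hi => ⟨hi.1, fun m h1 h2 => hi.2 m h1 (by omega)⟩

theorem sdiff_preimage_eq_longGaps : A \ σ ⁻¹' A = longGaps σ A 2 := by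
  ext i
  refine ⟨fun hi => ⟨hi.1, fun m h1 h2 => ?_⟩, fun hi => ⟨hi.1, fun h => ?_⟩⟩
  · obtain rfl : m = 1 := by omega
    simpa using hi.2
  · exact hi.2 1 le_rfl (by omega) (by simpa using h)

/-- The set `A` has no isolated element, all its gaps are shorter than `2 * g`, and at most `c`
of them have length `g` or more. -/
structure GapBound (σ : Equiv.Perm α) (A : Set α) (g c : ℕ) : Prop where
  nonempty : A.Nonempty
  adj : ∀ i ∈ A, σ i ∈ A ∨ σ.symm i ∈ A
  short : longGaps σ A (2 * g) = ∅
  card_le : (longGaps σ A g).ncard ≤ c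

theorem longGaps_insert_symm {w : α} (hg : 2 ≤ g) (hw : σ w ∈ A) :
    longGaps σ (insert w A) g ⊆ longGaps σ A g := by
  rintro i ⟨hi, hi2⟩
  rcases hi with rfl | hi
  · exact absurd (Or.inr hw) (by simpa using hi2 1 le_rfl (by omega))
  · exact ⟨hi, fun m h1 h2 h => hi2 m h1 h2 (Or.inr h)⟩

theorem mem_longGaps_of_insert {v : α} (hv : v ∈ A) (hw : σ v ∉ A)
    (h : σ v ∈ longGaps σ (insert (σ v) A) g) : v ∈ longGaps σ A g := by
  refine ⟨hv, fun m h1 h2 hm => ?_⟩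
  obtain ⟨m, rfl⟩ := Nat.exists_eq_add_of_le' h1
  rw [pow_succ, Equiv.Perm.mul_apply] at hm
  rcases m.eq_zero_or_pos with rfl | h3
  · exact hw hm
  · exact h.2 m h3 (by omega) (Or.inr hm)

/-- An element added at the start of a gap shortens it and becomes its new starting point, so `σ v`
is counted in place of `v`. An element added at the end starts no gap of length two. -/
theorem GapBound.insert [Finite α] {v w : α} (h : GapBound σ A g c) (hg : 2 ≤ g) (hv : v ∈ A)
    (hw : w ∉ A) (hvw : w = σ v ∨ v = σ w) : GapBound σ (insert w A) g c := by
  have hadj : ∀ i ∈ Insert.insert w A, σ i ∈ Insert.insert w A ∨ σ.symm i ∈ Insert.insert w A := by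
    rintro i (rfl | hi)
    · rcases hvw with rfl | rfl
      · right; right; simpa using hv
      · left; right; exact hv
    · exact (h.adj i hi).imp Or.inr Or.inr
  rcases hvw with rfl | rfl
  · have hnv : ∀ g, 2 ≤ g → v ∉ longGaps σ (Insert.insert (σ v) A) g := fun g hg hv' =>
      hv'.2 1 le_rfl (by omega) (by simp)
    have hmem : ∀ g, ∀ i ∈ longGaps σ (Insert.insert (σ v) A) g, i ≠ σ v → i ∈ longGaps σ A g :=
      fun g i hi hne => ⟨hi.1.resolve_left hne, fun m h1 h2 h => hi.2 m h1 h2 (Or.inr h)⟩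
    refine ⟨⟨v, Or.inr hv⟩, hadj, ?_, le_trans ?_ h.card_le⟩
    · refine Set.eq_empty_of_forall_notMem fun i hi => ?_
      by_cases hiv : i = σ v
      · subst hiv
        exact Set.notMem_empty v (h.short ▸ mem_longGaps_of_insert hv hw hi)
      · exact Set.notMem_empty i (h.short ▸ hmem _ i hi hiv)
    · classical
      refine Set.ncard_le_ncard_of_injOn (fun i => if i = σ v then v else i) ?_ ?_
        (Set.toFinite _)
      · intro i hi
        by_cases hiv : i = σ v
        · subst hiv
          simpa using mem_longGaps_of_insert hv hw hi
        · simpa [hiv] using hmem _ i hi hiv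
      · intro i hi j hj hij
        have hi' : i ≠ v := fun e => hnv g hg (e ▸ hi)
        have hj' : j ≠ v := fun e => hnv g hg (e ▸ hj)
        simp only at hij
        split_ifs at hij with h1 h2 h2
        · rw [h1, h2]
        · exact absurd hij.symm hj'
        · exact absurd hij hi'
        · exact hij
  · refine ⟨⟨_, Or.inr hv⟩, hadj, ?_, ?_⟩
    · exact Set.subset_eq_empty (longGaps_insert_symm (by omega) hv) h.short
    · exact (Set.ncard_le_ncard (longGaps_insert_symm hg hv) (Set.toFinite _)).trans h.card_le

/-- Two new consecutive elements in the middle of a longest gap. -/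
theorem GapBound.exists_split [Finite α] (h : GapBound σ A g c) (hg : 2 ≤ g)
    (hne : (longGaps σ A g).Nonempty) :
    ∃ j, GapBound σ (Insert.insert j (Insert.insert (σ j) A)) g (c - 1) := by
  obtain ⟨i, hi⟩ := hne
  have hex : ∃ m, 1 ≤ m ∧ m < 2 * g ∧ (σ ^ m) i ∈ A := by
    by_contra! hcon
    exact Set.notMem_empty i (h.short ▸ (⟨hi.1, hcon⟩ : i ∈ longGaps σ A (2 * g)))
  obtain ⟨γ, h1, h2, h3⟩ := hex
  have h4 : g ≤ γ := not_lt.1 fun hlt => hi.2 γ h1 hlt h3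
  -- As `g ≤ γ < 2 * g`, the remaining pieces, of lengths `γ / 2` and `γ - γ / 2 - 1`, are shorter
  -- than `g`.
  refine ⟨(σ ^ (γ / 2)) i, ?_⟩
  set A' := Insert.insert ((σ ^ (γ / 2)) i) (Insert.insert (σ ((σ ^ (γ / 2)) i)) A) with hA'
  have hsub : A ⊆ A' := fun _ h => Or.inr (Or.inr h)
  have hmemA : ∀ j ∈ longGaps σ A' g, j ∈ A := by
    rintro j ⟨hj, hj2⟩
    rcases hj with rfl | rfl | hj
    · exact absurd (show σ ((σ ^ (γ / 2)) i) ∈ A' from Or.inr (Or.inl rfl))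
        (by simpa using hj2 1 le_rfl (by omega))
    · have e : ∀ m, (σ ^ m) (σ ((σ ^ (γ / 2)) i)) = (σ ^ (m + 1 + γ / 2)) i := by
        intro m
        rw [pow_add, pow_add, pow_one, Equiv.Perm.mul_apply, Equiv.Perm.mul_apply]
      -- If the second piece is empty, the second new element is the end of the gap, already in `A`.
      rcases (γ - γ / 2 - 1).eq_zero_or_pos with h0 | h0
      · have := e 0
        rw [show 0 + 1 + γ / 2 = γ by omega] at this
        rw [pow_zero, Equiv.Perm.one_apply] at this
        rwa [this]
      · refine absurd (hsub ?_) (hj2 (γ - γ / 2 - 1) h0 (by omega))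
        rw [e, show γ - γ / 2 - 1 + 1 + γ / 2 = γ by omega]
        exact h3
    · exact hj
  have hlong : ∀ g', ∀ j ∈ longGaps σ A' g', j ∈ A → j ∈ longGaps σ A g' :=
    fun g' j hj hjA => ⟨hjA, fun m h1 h2 h => hj.2 m h1 h2 (hsub h)⟩
  refine ⟨⟨i, hsub hi.1⟩, ?_, ?_, ?_⟩
  · rintro j (rfl | rfl | hj)
    · left; right; left; rfl
    · right; left; simp
    · exact (h.adj j hj).imp (@hsub _) (@hsub _)
  · refine Set.eq_empty_of_forall_notMem fun j hj => ?_
    exact Set.notMem_empty j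
      (h.short ▸ hlong _ j hj (hmemA j (longGaps_anti (by omega : g ≤ 2 * g) hj)))
  · have hss : longGaps σ A' g ⊆ longGaps σ A g \ {i} := by
      refine fun j hj => ⟨hlong _ j hj (hmemA j hj), ?_⟩
      rintro rfl
      exact hj.2 (γ / 2) (by omega) (by omega) (Or.inl rfl)
    have h5 := Set.ncard_le_ncard hss (Set.toFinite _)
    rw [Set.ncard_sdiff_singleton_of_mem hi] at h5
    have := h.card_le
    omega

/-- As many blocks of `A` begin as end: both sides are the size of `A` minus the number of its
elements with successor in `A`. -/
theorem ncard_sdiff_image_perm [Finite α] : (A \ σ '' A).ncard = (A \ σ ⁻¹' A).ncard := by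
  have h1 := Set.ncard_inter_add_ncard_sdiff_eq_ncard A (σ '' A) (Set.toFinite _)
  have h2 := Set.ncard_inter_add_ncard_sdiff_eq_ncard A (σ ⁻¹' A) (Set.toFinite _)
  have h3 := Set.ncard_image_of_injective (A ∩ σ ⁻¹' A) σ.injective
  rw [Set.image_inter_preimage, Set.inter_comm] at h3
  omega

end Gaps

/-! ### The rotation of the cycle, and monotonicity in the tokens -/

theorem finRotate_pow_self {n : ℕ} (hn : 2 ≤ n) : finRotate n ^ n = 1 := by
  obtain ⟨m, rfl⟩ := Nat.exists_eq_add_of_le' hn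
  have h := isCycle_finRotate.orderOf (f := finRotate (m + 2))
  rw [support_finRotate, Finset.card_univ, Fintype.card_fin] at h
  have h2 := pow_orderOf_eq_one (finRotate (m + 2))
  rwa [h] at h2

theorem eq_univ_of_finRotate_mem {n : ℕ} (hn : 2 ≤ n) {A : Set (Fin n)} (hA : A.Nonempty)
    (h : ∀ i ∈ A, finRotate n i ∈ A) : A = Set.univ := by
  obtain ⟨m, rfl⟩ := Nat.exists_eq_add_of_le' hn
  obtain ⟨i, hi⟩ := hA
  have hs : ∀ j : Fin (m + 2), finRotate (m + 2) j ≠ j := fun j =>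
    Equiv.Perm.mem_support.1 (support_finRotate ▸ Finset.mem_univ j)
  refine Set.eq_univ_of_forall fun j => ?_
  obtain ⟨k, rfl⟩ := isCycle_finRotate.exists_pow_eq (hs i) (hs j)
  clear hs
  induction k with
  | zero => simpa using hi
  | succ k ih => rw [pow_succ', Equiv.Perm.mul_apply]; exact h _ ih

theorem cycleGraph_adj_iff_finRotate {n : ℕ} (hn : 2 ≤ n) {i j : Fin n} :
    (cycleGraph n).Adj i j ↔ j = finRotate n i ∨ i = finRotate n j := by
  obtain ⟨m, rfl⟩ := Nat.exists_eq_add_of_le' hn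
  rw [cycleGraph_adj, finRotate_apply, finRotate_apply, sub_eq_iff_eq_add',
    sub_eq_iff_eq_add', or_comm, add_comm i, add_comm j, add_comm 1 i, add_comm 1 j]

theorem BlueWins.mono {V : Type*} {G : SimpleGraph V} {q t t' : ℕ} {B : Set V}
    (h : BlueWins G q t B) (ht : t ≤ t') : BlueWins G q t' B := by
  induction h generalizing t' with
  | done t => exact .done t'
  | token t B v hv h ih =>
    obtain ⟨s, rfl⟩ := Nat.exists_eq_add_of_le' (show 1 ≤ t' by omega)
    exact .token s B v hv (ih (by omega))
  | force t B v w hvw h ih => exact .force t' B v w hvw (ih ht)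
  | select t B W hW next hnext h ih =>
    exact .select t' B W hW next hnext fun S h1 h2 => ih S h1 h2 ht

theorem BlueWins.of_insert {V : Type*} {G : SimpleGraph V} {q t : ℕ} {B : Set V} {v : V}
    (h : BlueWins G q t (insert v B)) : BlueWins G q (t + 1) B := by
  by_cases hv : v ∈ B
  · rw [Set.insert_eq_of_mem hv] at h
    exact h.mono (by omega)
  · exact .token t B v hv h

/-! ### Upper bound: Blue's halving strategy -/

namespace caterpillarCycle

variable {n : ℕ} {d : Fin n → ℕ}
variable {B : Set (Fin n ⊕ (Σ i : Fin n, Fin (d i)))}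

theorem adj_inr {b : Σ i : Fin n, Fin (d i)} {u}
    (h : (caterpillarCycle n d).Adj (Sum.inr b) u) : u = Sum.inl b.1 := by
  rcases u with j | c
  · exact congrArg Sum.inl (Eq.symm h)
  · exact h.elim

/-- The blue centers with a white neighbor. -/
def active (B : Set (Fin n ⊕ (Σ i : Fin n, Fin (d i)))) : Set (Fin n) :=
  {i | Sum.inl i ∈ B ∧ ∃ w, (caterpillarCycle n d).Adj (Sum.inl i) w ∧ w ∉ B}

/-- The white pendant vertices at the center `i`. -/
def whiteLeaves (B : Set (Fin n ⊕ (Σ i : Fin n, Fin (d i)))) (i : Fin n) : Set (Fin (d i)) :=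
  {a | Sum.inr ⟨i, a⟩ ∉ B}

theorem isForce_of_unique {i : Fin n} {w} (hi : Sum.inl i ∈ B)
    (hw : (caterpillarCycle n d).Adj (Sum.inl i) w) (hwB : w ∉ B)
    (h : ∀ u, (caterpillarCycle n d).Adj (Sum.inl i) u → u ∉ B → u = w) :
    IsForce (caterpillarCycle n d) B Set.univ (Sum.inl i) w := by
  refine ⟨hi, Set.eq_singleton_iff_unique_mem.2 ⟨⟨hw, trivial, hwB⟩, fun u hu => ?_⟩⟩
  exact h u hu.1 hu.2.2

/-- When all centers are blue, tokens on all but one of the white pendant vertices at each center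
suffice. -/
theorem blueWins_of_centers (q : ℕ) (hB : ∀ i, Sum.inl i ∈ B) :
    BlueWins (caterpillarCycle n d) q (∑ i, ((whiteLeaves B i).ncard - 1)) B := by
  induction hm : Bᶜ.ncard using Nat.strong_induction_on generalizing B with
  | _ m ih =>
    by_cases hu : B = Set.univ
    · subst hu
      exact .done _
    obtain ⟨w, hw⟩ := (Set.ne_univ_iff_exists_notMem B).1 hu
    rcases w with i | ⟨i, a⟩
    · exact absurd (hB i) hw
    have ih' := ih _ ?_ (B := insert (Sum.inr ⟨i, a⟩) B) (fun j => Or.inr (hB j)) rfl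
    swap
    · rw [← hm]
      refine Set.ncard_lt_ncard ?_ (Set.toFinite _)
      exact compl_lt_compl_iff_lt.2 (Set.ssubset_insert hw)
    have hle : ∀ j, whiteLeaves (insert (Sum.inr ⟨i, a⟩) B) j ⊆ whiteLeaves B j :=
      fun j b hb h => hb (Or.inr h)
    have hle' : ∀ j, (whiteLeaves (insert (Sum.inr ⟨i, a⟩) B) j).ncard - 1 ≤
        (whiteLeaves B j).ncard - 1 :=
      fun j => Nat.sub_le_sub_right (Set.ncard_le_ncard (hle j) (Set.toFinite _)) 1
    have ha : a ∈ whiteLeaves B i := hw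
    by_cases hone : ∀ b ∈ whiteLeaves B i, b = a
    · refine .force _ _ (Sum.inl i) (Sum.inr ⟨i, a⟩) (isForce_of_unique (hB i) rfl hw ?_)
        (ih'.mono (Finset.sum_le_sum fun j _ => hle' j))
      rintro (j | ⟨j, b⟩) hj hjB
      · exact absurd (hB j) hjB
      · obtain rfl : i = j := hj
        rw [hone b hjB]
    · push Not at hone
      obtain ⟨b, hb, hba⟩ := hone
      refine (BlueWins.token _ _ _ hw ih').mono (Finset.sum_lt_sum (fun j _ => hle' j)
        ⟨i, Finset.mem_univ i, ?_⟩)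
      have h1 : (whiteLeaves (insert (Sum.inr ⟨i, a⟩) B) i).ncard < (whiteLeaves B i).ncard := by
        refine Set.ncard_lt_ncard ⟨hle i, fun h => ?_⟩ (Set.toFinite _)
        exact h ha (Or.inl rfl)
      have h2 : 0 < (whiteLeaves (insert (Sum.inr ⟨i, a⟩) B) i).ncard := by
        refine (Set.ncard_pos (Set.toFinite _)).2 ⟨b, ?_⟩
        rintro (h | h)
        · simp at h
          exact hba h
        · exact hb h
      omega

/-- The only neighbor of the pendant vertex is blue, so no white walk leaves it. -/
theorem connectedComponentMk_inr_eq {b : Σ i : Fin n, Fin (d i)} {u} (hb : Sum.inr b ∈ Bᶜ)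
    (hi : Sum.inl b.1 ∈ B) (hu : u ∈ Bᶜ)
    (h : ((caterpillarCycle n d).induce Bᶜ).connectedComponentMk ⟨Sum.inr b, hb⟩ =
      ((caterpillarCycle n d).induce Bᶜ).connectedComponentMk ⟨u, hu⟩) : u = Sum.inr b := by
  obtain ⟨p⟩ := ConnectedComponent.exact h
  cases p with
  | nil => rfl
  | @cons _ v _ hadj p =>
    have h1 : (caterpillarCycle n d).Adj (Sum.inr b) v := hadj
    exact absurd (adj_inr h1 ▸ hi) v.2

/-- Blue announces one white pendant vertex at each of more than `q` blue centers, and colors one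
of them. -/
theorem blueWins_of_leaves {q t : ℕ} {I : Set (Fin n)} (hI : q + 1 ≤ I.ncard)
    (hB : ∀ i ∈ I, Sum.inl i ∈ B) (hL : ∀ i ∈ I, (whiteLeaves B i).Nonempty)
    (H : ∀ i ∈ I, ∀ a ∈ whiteLeaves B i,
      BlueWins (caterpillarCycle n d) q t (insert (Sum.inr ⟨i, a⟩) B)) :
    BlueWins (caterpillarCycle n d) q t B := by
  classical
  choose a ha using hL
  let f : I → WhiteComponent (caterpillarCycle n d) B := fun i =>
    ((caterpillarCycle n d).induce Bᶜ).connectedComponentMk ⟨Sum.inr ⟨i.1, a i.1 i.2⟩, ha i.1 i.2⟩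
  have hf : Function.Injective f := fun i j hij => by
    have := connectedComponentMk_inr_eq _ (hB i.1 i.2) _ hij
    simp only [Sum.inr.injEq, Sigma.mk.injEq] at this
    exact Subtype.ext this.1.symm
  have hex : ∀ S ⊆ Set.range f, S.Nonempty → ∃ i, f i ∈ S := by
    rintro S hS ⟨c, hc⟩
    obtain ⟨i, rfl⟩ := hS hc
    exact ⟨i, hc⟩
  refine .select t B (Set.range f) ?_ (fun S => if h : ∃ i, f i ∈ S then
    insert (Sum.inr ⟨h.choose.1, a h.choose.1 h.choose.2⟩) B else B) ?_ ?_
  · refine le_trans ?_ hf.encard_range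
    rw [ENat.card_coe_set_eq, ← (Set.toFinite I).cast_ncard_eq]
    exact_mod_cast hI
  · intro S hS hne
    right
    have h := hex S hS hne
    simp only [dif_pos h]
    refine ⟨Sum.inl h.choose.1, _, ⟨hB _ h.choose.2, ?_⟩, rfl⟩
    refine Set.eq_singleton_iff_unique_mem.2 ⟨⟨rfl, ⟨ha _ h.choose.2, h.choose_spec⟩,
      ha _ h.choose.2⟩, ?_⟩
    rintro u ⟨hu, ⟨huB, huS⟩, -⟩
    obtain ⟨j, hj⟩ := hS huS
    have := connectedComponentMk_inr_eq _ (hB j.1 j.2) _ hj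
    subst this
    have hj' : h.choose.1 = j.1 := hu
    rw [Subtype.ext hj']
  · intro S hS hne
    have h := hex S hS hne
    simp only [dif_pos h]
    exact H _ h.choose.2 _ (ha _ h.choose.2)

theorem preimage_insert_inl (i : Fin n) :
    Sum.inl ⁻¹' (insert (Sum.inl i) B) = insert i (Sum.inl ⁻¹' B) := by
  ext j
  simp

theorem preimage_insert_inr (b : Σ i : Fin n, Fin (d i)) :
    Sum.inl ⁻¹' (insert (Sum.inr b) B) = Sum.inl ⁻¹' B := by
  ext j
  simp

/-- Blue can play without tokens, and keep the bounds on the gaps, until at most `q` blue centers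
have white neighbors. -/
theorem blueWins_of_active_le (hn : 2 ≤ n) {q t g c : ℕ} (hg : 2 ≤ g)
    (H : ∀ B, GapBound (finRotate n) (Sum.inl ⁻¹' B) g c → (active B).ncard ≤ q →
      BlueWins (caterpillarCycle n d) q t B)
    (hB : GapBound (finRotate n) (Sum.inl ⁻¹' B) g c) :
    BlueWins (caterpillarCycle n d) q t B := by
  induction hm : Bᶜ.ncard using Nat.strong_induction_on generalizing B with
  | _ m ih =>
    by_cases hact : (active B).ncard ≤ q
    · exact H B hB hact
    have step : ∀ i w, Sum.inl i ∈ B → (caterpillarCycle n d).Adj (Sum.inl i) w → w ∉ B →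
        BlueWins (caterpillarCycle n d) q t (insert w B) := by
      intro i w hi hw hwB
      refine ih _ ?_ ?_ rfl
      · rw [← hm]
        refine Set.ncard_lt_ncard ?_ (Set.toFinite _)
        exact compl_lt_compl_iff_lt.2 (Set.ssubset_insert hwB)
      · rcases w with j | b
        · rw [preimage_insert_inl]
          exact hB.insert hg hi hwB ((cycleGraph_adj_iff_finRotate hn).1 hw)
        · rwa [preimage_insert_inr]
    by_cases hforce : ∃ i ∈ active B, ∃ w, IsForce (caterpillarCycle n d) B Set.univ (Sum.inl i) w
    · obtain ⟨i, hi, w, hw⟩ := hforce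
      have hmem := hw.2 ▸ Set.mem_singleton w
      exact .force _ _ _ w hw (step i w hi.1 hmem.1 hmem.2.2)
    push Not at hforce
    refine blueWins_of_leaves (I := active B) (by omega) (fun i hi => hi.1) (fun i hi => ?_)
      (fun i hi a ha => step i _ hi.1 rfl ha)
    obtain ⟨hiB, w, hw, hwB⟩ := hi
    by_contra hemp
    have hcenter : ∀ u, (caterpillarCycle n d).Adj (Sum.inl i) u → u ∉ B → ∃ j, u = Sum.inl j ∧
        (j = finRotate n i ∨ j = (finRotate n).symm i) := by
      rintro (j | ⟨j, a⟩) hu huB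
      · exact ⟨j, rfl, ((cycleGraph_adj_iff_finRotate hn).1 hu).imp id
          fun h => (Equiv.symm_apply_eq _).2 h |>.symm⟩
      · obtain rfl : i = j := hu
        exact absurd ⟨a, huB⟩ hemp
    refine hforce i ⟨hiB, w, hw, hwB⟩ w (isForce_of_unique hiB hw hwB fun u hu huB => ?_)
    obtain ⟨j, rfl, hj⟩ := hcenter w hw hwB
    obtain ⟨j', rfl, hj'⟩ := hcenter u hu huB
    -- One of the two cycle neighbors of `i` is blue, so two distinct white ones are impossible.
    have hA := hB.adj i hiB
    rcases hj with rfl | rfl <;> rcases hj' with rfl | rfl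
    · rfl
    · exact absurd hA (not_or.2 ⟨hwB, huB⟩)
    · exact absurd hA (not_or.2 ⟨huB, hwB⟩)
    · rfl

/-- Both ends of a gap are active, and no center is an end of two gaps, as it would be isolated. -/
theorem two_mul_ncard_longGaps_le (hn : 2 ≤ n) {g c : ℕ}
    (hB : GapBound (finRotate n) (Sum.inl ⁻¹' B) g c) :
    2 * (longGaps (finRotate n) (Sum.inl ⁻¹' B) 2).ncard ≤ (active B).ncard := by
  set A : Set (Fin n) := Sum.inl ⁻¹' B
  rw [two_mul, ← sdiff_preimage_eq_longGaps]
  nth_rw 1 [← ncard_sdiff_image_perm]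
  rw [← Set.ncard_union_eq ?_ (Set.toFinite _) (Set.toFinite _)]
  · refine Set.ncard_le_ncard ?_ (Set.toFinite _)
    rintro i (⟨hi, hi2⟩ | ⟨hi, hi2⟩)
    · refine ⟨hi, Sum.inl ((finRotate n).symm i),
        (cycleGraph_adj_iff_finRotate hn).2 (.inr (Equiv.apply_symm_apply _ _).symm),
        fun h => hi2 ⟨_, h, Equiv.apply_symm_apply _ _⟩⟩
    · exact ⟨hi, Sum.inl (finRotate n i), (cycleGraph_adj_iff_finRotate hn).2 (.inl rfl), hi2⟩
  · refine Set.disjoint_left.2 fun i hi hi2 => ?_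
    rcases hB.adj i hi.1 with h | h
    · exact hi2.2 h
    · exact hi.2 ⟨_, h, Equiv.apply_symm_apply _ _⟩

theorem blueWins_of_all_centers {q k : ℕ} (hd : ∀ i, d i ≤ k) (hB : ∀ i, Sum.inl i ∈ B)
    (hact : (active B).ncard ≤ q) : BlueWins (caterpillarCycle n d) q (q * (k - 1)) B := by
  classical
  refine (blueWins_of_centers q hB).mono ?_
  calc ∑ i, ((whiteLeaves B i).ncard - 1) ≤ ∑ i, if i ∈ active B then k - 1 else 0 := by
        refine Finset.sum_le_sum fun i _ => ?_
        split_ifs with hi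
        · have h1 : (whiteLeaves B i).ncard ≤ d i := by
            simpa using Set.ncard_le_card (whiteLeaves B i)
          have h2 := hd i
          omega
        · have : whiteLeaves B i = ∅ := Set.eq_empty_of_forall_notMem fun a ha =>
            hi ⟨hB i, Sum.inr ⟨i, a⟩, rfl, ha⟩
          simp [this]
    _ = (active B).ncard * (k - 1) := by
        rw [← Finset.sum_filter, Finset.sum_const, smul_eq_mul, Set.ncard_eq_toFinset_card']
        congr 2
        ext i
        simp
    _ ≤ q * (k - 1) := Nat.mul_le_mul_right _ hact

theorem blueWins_of_card_longGaps (hn : 2 ≤ n) {q t g : ℕ} (hg : 2 ≤ g)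
    (base : ∀ B, GapBound (finRotate n) (Sum.inl ⁻¹' B) g 0 → (active B).ncard ≤ q →
      BlueWins (caterpillarCycle n d) q t B) (c : ℕ) :
    ∀ B, GapBound (finRotate n) (Sum.inl ⁻¹' B) g c →
      BlueWins (caterpillarCycle n d) q (t + 2 * c) B := by
  induction c with
  | zero => exact fun B hB => blueWins_of_active_le hn hg base hB
  | succ c ih =>
    refine fun B hB => blueWins_of_active_le hn hg (fun B hB hact => ?_) hB
    by_cases hne : (longGaps (finRotate n) (Sum.inl ⁻¹' B) g).Nonempty
    · obtain ⟨j, hj⟩ := hB.exists_split hg hne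
      rw [← preimage_insert_inl, ← preimage_insert_inl] at hj
      exact (ih _ hj).of_insert.of_insert
    · have h0 : GapBound (finRotate n) (Sum.inl ⁻¹' B) g 0 :=
        ⟨hB.nonempty, hB.adj, hB.short, by simp [Set.not_nonempty_iff_eq_empty.1 hne]⟩
      exact (base B h0 hact).mono (by omega)

/-- Once no gap reaches the current threshold and at most `q` centers are active, at most `q / 2`
gaps reach half of it; these are the `c` of the next round. At threshold `2` no white center
remains. -/
theorem blueWins_of_gapBound (hn : 2 ≤ n) {q k : ℕ} (hd : ∀ i, d i ≤ k) (R : ℕ) :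
    ∀ (c : ℕ) (B : Set (Fin n ⊕ (Σ i : Fin n, Fin (d i)))),
      GapBound (finRotate n) (Sum.inl ⁻¹' B) (2 ^ (R + 1)) c →
      BlueWins (caterpillarCycle n d) q (q * (k - 1) + 2 * (q / 2) * R + 2 * c) B := by
  induction R with
  | zero =>
    refine fun c => blueWins_of_card_longGaps hn (by simp) (fun B hB hact => ?_) c
    have h0 := (Set.ncard_eq_zero (Set.toFinite _)).1 (Nat.le_zero.1 hB.card_le)
    have hu := eq_univ_of_finRotate_mem hn hB.nonempty fun i hi => by
      by_contra h
      have : i ∈ longGaps (finRotate n) (Sum.inl ⁻¹' B) 2 :=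
        sdiff_preimage_eq_longGaps.subset ⟨hi, h⟩
      simp only [zero_add, pow_one] at h0
      simp [h0] at this
    exact blueWins_of_all_centers hd (fun i => (hu ▸ Set.mem_univ i : i ∈ Sum.inl ⁻¹' B)) hact
  | succ R ih =>
    have hpow : 2 ≤ 2 ^ (R + 1) := by
      simpa using Nat.pow_le_pow_right (n := 2) (by omega) (show 1 ≤ R + 1 by omega)
    have hpow' : 2 ^ (R + 1 + 1) = 2 * 2 ^ (R + 1) := pow_succ' _ _
    refine fun c => blueWins_of_card_longGaps hn (by omega) (fun B hB hact => ?_) c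
    have h0 := (Set.ncard_eq_zero (Set.toFinite _)).1 (Nat.le_zero.1 hB.card_le)
    have h2 := two_mul_ncard_longGaps_le hn hB
    have h3 := Set.ncard_le_ncard (longGaps_anti (σ := finRotate n) (A := Sum.inl ⁻¹' B) hpow)
      (Set.toFinite _)
    refine (ih (q / 2) B ⟨hB.nonempty, hB.adj, hpow' ▸ h0, by omega⟩).mono ?_
    rw [Nat.mul_succ]
    omega

theorem blueWins_empty (hn : 3 ≤ n) {q k : ℕ} (hd : ∀ i, d i ≤ k) :
    BlueWins (caterpillarCycle n d) q
      (q * (k - 1) + 2 * (q / 2) * (Nat.log 2 (n - 1) - 1) + 4) ∅ := by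
  have hlog : 1 ≤ Nat.log 2 (n - 1) := Nat.log_pos (by omega) (by omega)
  have hlt := Nat.lt_pow_succ_log_self (b := 2) (by omega) (n - 1)
  obtain ⟨R, hR⟩ := Nat.exists_eq_add_of_le' hlog
  rw [hR] at hlt ⊢
  have hpow : 2 ≤ 2 ^ (R + 1) := by
    simpa using Nat.pow_le_pow_right (n := 2) (by omega) (show 1 ≤ R + 1 by omega)
  rw [pow_succ'] at hlt
  let i : Fin n := ⟨0, by omega⟩
  set σ := finRotate n
  -- Two adjacent tokens leave one gap, of length `n - 1 < 2 * 2 ^ (R + 1)`. They and the two tokens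
  -- that split it make up the constant `4`.
  have hA : GapBound σ {i, σ i} (2 ^ (R + 1)) 1 := by
    have h1 : longGaps σ {i, σ i} (2 ^ (R + 1)) ⊆ {σ i} := by
      rintro j ⟨rfl | hj, hj2⟩
      · exact absurd (hj2 1 le_rfl (by omega)) (by simp)
      · exact hj
    refine ⟨⟨i, Or.inl rfl⟩, ?_, Set.eq_empty_of_forall_notMem fun j hj => ?_, ?_⟩
    · rintro j (rfl | rfl)
      · left; right; rfl
      · right; left; exact Equiv.symm_apply_apply _ _
    · obtain rfl := h1 (longGaps_anti (by omega) hj)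
      refine hj.2 (n - 1) (by omega) hlt (Or.inl ?_)
      rw [← Equiv.Perm.mul_apply, ← pow_succ, Nat.sub_add_cancel (by omega),
        finRotate_pow_self (by omega), Equiv.Perm.one_apply]
    · simpa using Set.ncard_le_ncard h1
  have hpre : Sum.inl ⁻¹' (insert (Sum.inl i) (insert (Sum.inl (σ i)) ∅) :
      Set (Fin n ⊕ (Σ i : Fin n, Fin (d i)))) = {i, σ i} := by
    rw [preimage_insert_inl (d := d), preimage_insert_inl (d := d)]
    simp
  exact (blueWins_of_gapBound (by omega) hd R 1 _ (hpre ▸ hA)).of_insert.of_insert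

end caterpillarCycle

open caterpillarCycle in
theorem theorem4p19 (n k q x p : ℕ) (d : Fin n → ℕ) (hn : 3 ≤ n) (hk : 2 ≤ k) (hq : 2 ≤ q)
    (hx : x ≡ q + 1 [MOD 2]) (hp : p = q + 1 + x) (hd : ∀ i, 2 ≤ d i ∧ d i ≤ k) :
    (3 ≤ q →
      2 * Real.logb 3 2 * Real.logb 2 ((n : ℝ) / 200) ≤ (Zq (caterpillarCycle n d) q : ℝ)) ∧
    (Zq (caterpillarCycle n d) q : ℝ) ≤
      ((p : ℝ) - 2) * Real.logb 2 (n : ℝ) + (p : ℝ) + (k : ℝ) - (q : ℝ)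
        + (q : ℝ) * ((k : ℝ) - 1) := by
  refine ⟨fun hq3 => logb_le_of_blueWins (fun i => (hd i).1) (by omega) hq3
    (Nat.sInf_mem (exists_blueWins (caterpillarCycle n d) q)), ?_⟩
  have hle : Zq (caterpillarCycle n d) q ≤
      q * (k - 1) + 2 * (q / 2) * (Nat.log 2 (n - 1) - 1) + 4 :=
    Nat.sInf_le (blueWins_empty hn fun i => (hd i).2)
  have hlog : 1 ≤ Nat.log 2 (n - 1) := Nat.log_pos (by omega) (by omega)
  have hreal : (Nat.log 2 (n - 1) : ℝ) ≤ Real.logb 2 n :=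
    (Nat.cast_le.2 (Nat.log_mono_right (Nat.sub_le n 1))).trans (Real.natLog_le_logb n 2)
  have hcast : (Zq (caterpillarCycle n d) q : ℝ) ≤
      q * ((k : ℝ) - 1) + 2 * (q / 2 : ℕ) * ((Nat.log 2 (n - 1) : ℝ) - 1) + 4 := by
    have h : ((q * (k - 1) + 2 * (q / 2) * (Nat.log 2 (n - 1) - 1) + 4 : ℕ) : ℝ) =
        q * ((k : ℝ) - 1) + 2 * (q / 2 : ℕ) * ((Nat.log 2 (n - 1) : ℝ) - 1) + 4 := by
      push_cast [Nat.cast_sub hlog, Nat.cast_sub (show 1 ≤ k by omega)]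
      ring
    rw [← h]
    exact_mod_cast hle
  -- The parity of `x` matters for even `q`: it makes `x` odd, so `p ≥ q + 2`.
  have hpq : 2 * (q / 2) + 2 ≤ p := by
    unfold Nat.ModEq at hx
    omega
  have hpq' : 2 * ((q / 2 : ℕ) : ℝ) + 2 ≤ p := by exact_mod_cast hpq
  have hp1 : (q : ℝ) + 1 ≤ p := by exact_mod_cast (show q + 1 ≤ p by omega)
  have hk' : (2 : ℝ) ≤ k := by exact_mod_cast hk
  have hq' : (1 : ℝ) ≤ (q / 2 : ℕ) := by exact_mod_cast (show 1 ≤ q / 2 by omega)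
  have hlog' : (1 : ℝ) ≤ Nat.log 2 (n - 1) := by exact_mod_cast hlog
  have h1 : 2 * ((q / 2 : ℕ) : ℝ) * Nat.log 2 (n - 1) ≤ (p - 2) * Real.logb 2 n :=
    mul_le_mul (by linarith) hreal (by linarith) (by linarith)
  linarith
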